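/- Let $n\in\mathbb N$ and let $\Omega\subset\mathbb C^n$ be a Reinhardt domain, i.e. a nonempty connected open set such that $(\zeta_1z_1,\dots,\zeta_nz_n)\in\Omega$ whenever $z\in\Omega$ and $\zeta\in (S^1)^n$, where $S^1=\{\zeta\in\mathbb C:|\zeta|=1\}$. Let $u:\Omega\to\mathbb R$ be plurisubharmonic (that is, upper semicontinuous, and subharmonic along every complex line intersected with $\Omega$) and bounded from below. Suppose that $u$ is torically uniformly continuous, i.e. that the family of functions $$u_z:(S^1)^n\to\mathbb R,\qquad u_z(\zeta_1,\dots,\zeta_n)=u(\zeta_1z_1,\dots,\zeta_nz_n),\qquad z\in\Omega,$$ is equicontinuous on $(S^1)^n$. Then $u$ is continuous on $\Omega$. -/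

import Mathlib

open MeasureTheory

noncomputable section

/-- The action of the torus `S¹ × ⋯ × S¹` on `ℂⁿ`:
`(ζ₁, …, ζₙ) · (z₁, …, zₙ) = (ζ₁ z₁, …, ζₙ zₙ)`. -/
def toricAct {n : ℕ} (ζ : Fin n → Circle) (z : Fin n → ℂ) : Fin n → ℂ :=
  fun j => (ζ j : ℂ) * z j

/-- A Reinhardt domain in `ℂⁿ`: a nonempty connected open set that is invariant under the
toric action. -/
structure IsReinhardtDomain {n : ℕ} (Ω : Set (Fin n → ℂ)) : Prop where
  isOpen : IsOpen Ω
  isConnected : IsConnected Ω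
  toricAct_mem : ∀ (ζ : Fin n → Circle), ∀ z ∈ Ω, toricAct ζ z ∈ Ω

/-- The mean value of an extended real function over the circle of center `c` and radius `R`,
that is, the mean of the positive part minus the mean of the negative part. For a function that
is bounded above (the only case used below) the first mean is finite, and the value is the usual
Lebesgue integral in `[-∞, ∞)`. -/
def ecircleAverage (f : ℂ → EReal) (c : ℂ) (R : ℝ) : EReal :=
  ((⨍⁻ θ in Set.Ioc 0 (2 * Real.pi), (f (circleMap c R θ)).toENNReal ∂volume : ENNReal) : EReal) -
    ((⨍⁻ θ in Set.Ioc 0 (2 * Real.pi), (-f (circleMap c R θ)).toENNReal ∂volume : ENNReal) : EReal)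

/-- Subharmonic functions `U → [-∞, ∞)` on an open set `U ⊆ ℂ`: upper semicontinuous functions
with the sub-mean value property on every closed disc in `U`. The function `-∞` is allowed. -/
structure IsSubharmonicOn (f : ℂ → EReal) (U : Set ℂ) : Prop where
  upperSemicontinuousOn : UpperSemicontinuousOn f U
  lt_top : ∀ c ∈ U, f c < ⊤
  le_average : ∀ (c : ℂ) (R : ℝ), 0 < R → Metric.closedBall c R ⊆ U → f c ≤ ecircleAverage f c R

/-- Plurisubharmonic functions `Ω → [-∞, ∞)` on an open set `Ω ⊆ ℂⁿ`: upper semicontinuous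
functions whose restriction to every complex line is subharmonic. -/
structure IsPlurisubharmonicOn {n : ℕ} (u : (Fin n → ℂ) → EReal) (Ω : Set (Fin n → ℂ)) :
    Prop where
  upperSemicontinuousOn : UpperSemicontinuousOn u Ω
  lt_top : ∀ z ∈ Ω, u z < ⊤
  isSubharmonicOn_line : ∀ a b : Fin n → ℂ,
    IsSubharmonicOn (fun c : ℂ => u (a + c • b)) {c : ℂ | a + c • b ∈ Ω}

/-- The class `T(A)` of torically uniformly continuous functions on a torically invariant set `A`:
the family of functions `F_z : ζ ↦ F (ζ · z)` on the torus, `z ∈ A`, is equicontinuous. -/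
def IsToricallyUniformlyContinuousOn {n : ℕ} (F : (Fin n → ℂ) → ℝ) (A : Set (Fin n → ℂ)) : Prop :=
  Equicontinuous (fun (z : A) (ζ : Fin n → Circle) => F (toricAct ζ z))

end

section

open Set Filter Topology Metric

/-! Only lower semicontinuity at `z₀` is at stake. Split the coordinates by whether they vanish at
`z₀`. Vanishing ones (`exists_le_add_of_eq_of_ne_zero`): if only these move, the circle `z₀ +
e^{iθ}(z - z₀)` is a toric orbit of `z`. A low value at `z` persists on an arc of fixed length,
upper semicontinuity bounds `u` elsewhere on the circle, and the mean would drop below `u z₀`.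
Nonvanishing ones (`exists_le_update_add`, one at a time): a small change of argument is harmless by
toric equicontinuity. For a radial change, `u` is nearly constant on an arc of the circle through
the point, and boundedness lets a harmonic barrier carry the upper bound off that arc
(`le_of_le_on_arc`). -/

/-! ### Subharmonic functions of one variable: maximum principle and barriers. -/

/-- An integrable majorant suffices, so neither measurability nor integrability of `f` is needed:
positive and negative parts are compared separately, and those of `g` have finite means. -/
lemma ecircleAverage_coe_le {f : ℂ → ℝ} {c : ℂ} {R : ℝ} {g : ℝ → ℝ}
    (hg : IntegrableOn g (Ioc 0 (2 * Real.pi)))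
    (hfg : ∀ θ, f (circleMap c R θ) ≤ g θ) :
    ecircleAverage (fun w => (f w : EReal)) c R
      ≤ ((⨍ θ in Ioc 0 (2 * Real.pi), g θ : ℝ) : EReal) := by
  have hgi : Integrable g
      ((volume.restrict (Ioc 0 (2 * Real.pi)) univ)⁻¹ • volume.restrict (Ioc 0 (2 * Real.pi))) := by
    refine Integrable.smul_measure hg ?_
    simp [Real.pi_pos]
  have hfin : ∀ h : ℝ → ℝ, Integrable h ((volume.restrict (Ioc 0 (2 * Real.pi)) univ)⁻¹ •
      volume.restrict (Ioc 0 (2 * Real.pi))) →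
      ((⨍⁻ θ in Ioc 0 (2 * Real.pi), ENNReal.ofReal (h θ) ∂volume : ENNReal) : EReal) =
      ((⨍⁻ θ in Ioc 0 (2 * Real.pi), ENNReal.ofReal (h θ) ∂volume : ENNReal).toReal : EReal) := by
    intro h hh
    exact (EReal.coe_ennreal_toReal hh.lintegral_lt_top.ne).symm
  have key : ((⨍ θ in Ioc 0 (2 * Real.pi), g θ : ℝ) : EReal) =
      ((⨍⁻ θ in Ioc 0 (2 * Real.pi), ENNReal.ofReal (g θ) ∂volume : ENNReal) : EReal) -
      ((⨍⁻ θ in Ioc 0 (2 * Real.pi), ENNReal.ofReal (-g θ) ∂volume : ENNReal) : EReal) := by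
    rw [hfin g hgi, hfin (fun θ => -g θ) hgi.neg, ← EReal.coe_sub]
    congr 1
    exact integral_eq_lintegral_pos_part_sub_lintegral_neg_part hgi
  rw [key]
  refine EReal.sub_le_sub ?_ ?_
  · refine EReal.coe_ennreal_le_coe_ennreal_iff.2 (lintegral_mono fun θ => ?_)
    exact ENNReal.ofReal_le_ofReal (hfg θ)
  · refine EReal.coe_ennreal_le_coe_ennreal_iff.2 (lintegral_mono fun θ => ?_)
    exact ENNReal.ofReal_le_ofReal (neg_le_neg (hfg θ))

namespace IsSubharmonicOn

variable {f : ℂ → ℝ} {U : Set ℂ}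

lemma le_setAverage (hf : IsSubharmonicOn (fun w => (f w : EReal)) U) {c : ℂ} {R : ℝ}
    (hR : 0 < R) (hU : closedBall c R ⊆ U) {g : ℝ → ℝ}
    (hg : IntegrableOn g (Ioc 0 (2 * Real.pi))) (hfg : ∀ θ, f (circleMap c R θ) ≤ g θ) :
    f c ≤ ⨍ θ in Ioc 0 (2 * Real.pi), g θ :=
  EReal.coe_le_coe_iff.1 ((hf.le_average c R hR hU).trans (ecircleAverage_coe_le hg hfg))

lemma le_re_of_le_on_sphere (hf : IsSubharmonicOn (fun w => (f w : EReal)) U) {c : ℂ} {R : ℝ}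
    (hR : 0 < R) (hU : closedBall c R ⊆ U) {G : ℂ → ℂ} (hG : DiffContOnCl ℂ G (ball c R))
    (hfG : ∀ w ∈ sphere c R, f w ≤ (G w).re) : f c ≤ (G c).re := by
  have hcont : Continuous fun θ => G (circleMap c R θ) := by
    have h1 : ContinuousOn G (closedBall c R) := by
      simpa [closure_ball c hR.ne'] using hG.continuousOn
    exact h1.comp_continuous (continuous_circleMap c R)
      fun θ => circleMap_mem_closedBall c hR.le θ
  have hmean := DiffContOnCl.circleAverage (f := G) (c := c) (R := R) (by rwa [abs_of_pos hR])
  have hint : ∀ {E : Type} [NormedAddCommGroup E] (h : ℝ → E), Continuous h →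
      IntegrableOn h (Ioc 0 (2 * Real.pi)) := fun h hh =>
    (hh.integrableOn_Icc).mono_set Ioc_subset_Icc_self
  have h := hf.le_setAverage hR hU (hint _ (Complex.continuous_re.comp hcont))
    fun θ => hfG _ (circleMap_mem_sphere c hR.le θ)
  refine h.trans_eq ?_
  rw [Real.circleAverage_eq_intervalAverage, uIoc_of_le (by positivity)] at hmean
  rw [← hmean, setAverage_eq, setAverage_eq, Complex.smul_re]
  congr 1
  exact integral_re (𝕜 := ℂ) (hint _ hcont)

lemma upperSemicontinuousOn_real (hf : IsSubharmonicOn (fun w => (f w : EReal)) U) :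
    UpperSemicontinuousOn f U := fun x hx y hy => by
  simpa using hf.upperSemicontinuousOn x hx y (EReal.coe_lt_coe_iff.2 hy)

/-- Maximum principle for the difference of a subharmonic function and the real part of a
holomorphic function. -/
theorem le_re_of_le_on_frontier (hf : IsSubharmonicOn (fun w => (f w : EReal)) U)
    {K V : Set ℂ} (hK : IsCompact K) (hKU : K ⊆ U) (hKV : K ⊆ V)
    {G : ℂ → ℂ} (hG : DifferentiableOn ℂ G V)
    (hfG : ∀ w ∈ frontier K, f w ≤ (G w).re) {c : ℂ} (hc : c ∈ K) : f c ≤ (G c).re := by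
  obtain ⟨C, hC⟩ := hK.isBounded.exists_norm_le
  have hCsq : ∀ w ∈ K, ‖w‖ ^ 2 ≤ C ^ 2 := fun w hw =>
    pow_le_pow_left₀ (norm_nonneg _) (hC w hw) 2
  -- The term `κ * ‖w‖ ^ 2` makes `f - Re G` strictly subharmonic, which rules out interior maxima;
  -- `κ → 0` at the end.
  have main : ∀ κ > 0, f c - (G c).re ≤ κ * C ^ 2 := by
    intro κ hκ
    have hcont : ContinuousOn (fun w => -(G w).re + κ * ‖w‖ ^ 2) K :=
      ((Complex.continuous_re.comp_continuousOn (hG.continuousOn.mono hKV)).neg).add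
        (by fun_prop)
    obtain ⟨p, hpK, hp⟩ := UpperSemicontinuousOn.exists_isMaxOn ⟨c, hc⟩ hK
      ((hf.upperSemicontinuousOn_real.mono hKU).add hcont.upperSemicontinuousOn)
    have hmax : ∀ w ∈ K, f w + (-(G w).re + κ * ‖w‖ ^ 2) ≤ f p + (-(G p).re + κ * ‖p‖ ^ 2) :=
      fun w hw => hp hw
    by_cases hpi : p ∈ interior K
    · exfalso
      obtain ⟨s, hs, hsK⟩ := nhds_basis_closedBall.mem_iff.1 (mem_interior_iff_mem_nhds.1 hpi)
      -- On the sphere of radius `s` about `p`, `‖w‖ ^ 2` is the real part of an affine function of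
      -- `w`. Maximality at `p` then reads `f ≤ Re H` there, although `Re (H p) = f p - κ * s ^ 2 <
      -- f p`.
      let H : ℂ → ℂ := fun w => G w + ((f p - (G p).re - κ * s ^ 2 : ℝ) : ℂ)
        - ((2 * κ : ℝ) : ℂ) * ((starRingEnd ℂ) p * (w - p))
      have hH : DiffContOnCl ℂ H (ball p s) := by
        refine DifferentiableOn.diffContOnCl ?_
        rw [closure_ball p hs.ne']
        have := hG.mono (hsK.trans hKV)
        fun_prop
      have h := hf.le_re_of_le_on_sphere hs (hsK.trans hKU) hH ?_
      · simp only [H, sub_self, mul_zero, Complex.add_re, Complex.ofReal_re, sub_zero] at h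
        nlinarith [mul_pos hκ (pow_pos hs 2)]
      · intro w hw
        have h1 := hmax w (hsK (sphere_subset_closedBall hw))
        have h2 : ‖w - p‖ = s := mem_sphere_iff_norm.1 hw
        have h3 : ‖w‖ ^ 2 = ‖p‖ ^ 2 + s ^ 2 + 2 * ((starRingEnd ℂ) p * (w - p)).re := by
          rw [← h2, Complex.sq_norm, Complex.sq_norm, Complex.sq_norm]
          simp only [Complex.normSq_apply, Complex.mul_re, Complex.sub_re, Complex.sub_im,
            Complex.conj_re, Complex.conj_im]
          ring
        simp only [H, Complex.add_re, Complex.sub_re, Complex.ofReal_re, Complex.re_ofReal_mul]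
        rw [h3] at h1
        nlinarith
    · have hpf : p ∈ frontier K := ⟨subset_closure hpK, hpi⟩
      have h1 := hmax c hc
      have h2 := hfG p hpf
      have h3 := mul_le_mul_of_nonneg_left (hCsq p hpK) hκ.le
      have h4 : 0 ≤ κ * ‖c‖ ^ 2 := by positivity
      linarith
  have hlim : Tendsto (fun κ : ℝ => κ * C ^ 2) (𝓝[>] 0) (𝓝 0) := by
    have : Tendsto (fun κ : ℝ => κ * C ^ 2) (𝓝 0) (𝓝 (0 * C ^ 2)) := by
      exact (continuous_id.mul continuous_const).tendsto 0
    rw [zero_mul] at this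
    exact this.mono_left nhdsWithin_le_nhds
  have := ge_of_tendsto hlim (eventually_nhdsWithin_of_forall main)
  linarith

/-- A bounded subharmonic function on a disc centred at `c₁` that is at most `A` on the arc of the
circle `|w| = |c₁|` inside the disc is at most slightly more than `A` at the points of the ray
through `c₁` near `c₁`. -/
theorem le_of_le_on_arc (hf : IsSubharmonicOn (fun w => (f w : EReal)) U) {c₁ : ℂ} (hc₁ : c₁ ≠ 0)
    {ρ : ℝ} (hρ : 0 < ρ) (hρ' : ρ ≤ 1 / 2) (hU : closedBall c₁ (ρ * ‖c₁‖) ⊆ U) {A B : ℝ}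
    (hB : 0 ≤ B) (hAB : ∀ w ∈ closedBall c₁ (ρ * ‖c₁‖), f w ≤ A + B)
    (hA : ∀ w ∈ closedBall c₁ (ρ * ‖c₁‖), ‖w‖ = ‖c₁‖ → f w ≤ A) {s : ℝ} (hs : |1 - s| ≤ ρ) :
    f (s * c₁) ≤ A + B * (8 / ρ ^ 2 * |1 - s|) := by
  have hn : 0 < ‖c₁‖ := norm_pos_iff.2 hc₁
  have hs0 : 0 < s := by linarith [(abs_le.1 hs).2]
  have hmem : (s : ℂ) * c₁ ∈ closedBall c₁ (ρ * ‖c₁‖) := by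
    rw [mem_closedBall, dist_eq_norm, show (s : ℂ) * c₁ - c₁ = ((s - 1 : ℝ) : ℂ) * c₁ by
      push_cast; ring, norm_mul, Complex.norm_real, Real.norm_eq_abs, abs_sub_comm]
    gcongr
  -- With `z = w / c₁` and `|z - 1| = ρ`, `1 - Re z ≥ ρ² / 2` if `|z| ≤ 1`, and `1 - Re z⁻¹ ≥ ρ² /
  -- 8` if `1 ≤ |z| ≤ 2`. The factor `8 / ρ ^ 2` lifts both barriers to at least `1` there.
  have hα : 0 < 8 / ρ ^ 2 := by positivity
  have hscale : ∀ w, ‖w‖ = ‖c₁‖ * ‖w / c₁‖ := fun w => by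
    rw [norm_div]; field_simp
  have hdist : ∀ w, dist w c₁ = ‖c₁‖ * ‖w / c₁ - 1‖ := fun w => by
    rw [dist_eq_norm, ← norm_mul]; congr 1; field_simp
  have hone : ∀ z : ℂ, ‖z - 1‖ ^ 2 = ‖z‖ ^ 2 + 1 - 2 * z.re := fun z => by
    rw [Complex.sq_norm, Complex.sq_norm, Complex.normSq_apply, Complex.normSq_apply]
    simp; ring
  have hfr : ∀ K₂ : Set ℂ, ∀ w ∈ frontier (closedBall c₁ (ρ * ‖c₁‖) ∩ K₂), IsClosed K₂ →
      frontier K₂ ⊆ {w | ‖w‖ = ‖c₁‖} →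
      w ∈ closedBall c₁ (ρ * ‖c₁‖) ∧ w ∈ K₂ ∧ (‖w / c₁ - 1‖ = ρ ∨ ‖w‖ = ‖c₁‖) := by
    intro K₂ w hw hcl hK₂
    have hw' := (isClosed_closedBall.inter hcl).frontier_subset hw
    refine ⟨hw'.1, hw'.2, ?_⟩
    rcases frontier_inter_subset _ _ hw with h | h
    · left
      have := frontier_closedBall_subset_sphere h.1
      rw [mem_sphere, hdist, mul_comm] at this
      exact mul_right_cancel₀ hn.ne' this
    · right; exact hK₂ h.2
  -- The barrier must be nonnegative on its side of the circle: `1 - w / c₁` serves inside, its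
  -- inversion `1 - c₁ / w` outside.
  rcases le_total s 1 with h1 | h1
  · have hcl : IsClosed {w : ℂ | ‖w‖ ≤ ‖c₁‖} := isClosed_le continuous_norm continuous_const
    have h := hf.le_re_of_le_on_frontier
      (K := closedBall c₁ (ρ * ‖c₁‖) ∩ {w | ‖w‖ ≤ ‖c₁‖}) (V := univ) (c := (s : ℂ) * c₁)
      (G := fun w => (A : ℂ) + ((B * (8 / ρ ^ 2) : ℝ) : ℂ) * (1 - w / c₁))
      ((isCompact_closedBall _ _).inter_right hcl) (inter_subset_left.trans hU)
      (subset_univ _) (by fun_prop) ?_ ⟨hmem, ?_⟩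
    · rw [abs_of_nonneg (by linarith)]
      rw [mul_div_cancel_right₀ _ hc₁] at h
      simpa [Complex.add_re, Complex.re_ofReal_mul, mul_assoc, -Complex.ofReal_mul] using h
    · intro w hw
      obtain ⟨hwB, hwK, hcase⟩ := hfr _ w hw hcl
        (frontier_le_subset_eq continuous_norm continuous_const)
      simp only [Complex.add_re, Complex.ofReal_re, Complex.re_ofReal_mul, Complex.sub_re,
        Complex.one_re]
      have hz := hone (w / c₁)
      have hzle : ‖w / c₁‖ ≤ 1 := by
        have : ‖c₁‖ * ‖w / c₁‖ ≤ ‖c₁‖ * 1 := by rw [← hscale]; simpa using hwK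
        exact le_of_mul_le_mul_left this hn
      rcases hcase with h | h
      · refine (hAB w hwB).trans ?_
        have h2 : 1 ≤ 8 / ρ ^ 2 * (1 - (w / c₁).re) := by
          rw [h] at hz
          rw [div_mul_eq_mul_div, le_div_iff₀ (by positivity)]
          nlinarith [norm_nonneg (w / c₁)]
        nlinarith
      · refine (hA w hwB h).trans ?_
        have h2 : 0 ≤ 1 - (w / c₁).re := by
          linarith [Complex.re_le_norm (w / c₁)]
        have : 0 ≤ B * (8 / ρ ^ 2) * (1 - (w / c₁).re) := by positivity
        linarith
    · simp only [mem_ofPred_eq, norm_mul, Complex.norm_real, Real.norm_eq_abs, abs_of_pos hs0]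
      nlinarith
  · have hcl : IsClosed {w : ℂ | ‖c₁‖ ≤ ‖w‖} := isClosed_le continuous_const continuous_norm
    have h := hf.le_re_of_le_on_frontier
      (K := closedBall c₁ (ρ * ‖c₁‖) ∩ {w | ‖c₁‖ ≤ ‖w‖}) (V := {0}ᶜ) (c := (s : ℂ) * c₁)
      (G := fun w => (A : ℂ) + ((B * (8 / ρ ^ 2) : ℝ) : ℂ) * (1 - c₁ / w))
      ((isCompact_closedBall _ _).inter_right hcl) (inter_subset_left.trans hU)
      ?_ ?_ ?_ ⟨hmem, ?_⟩
    · rw [abs_of_nonpos (by linarith)]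
      have hq : (c₁ / ((s : ℂ) * c₁)) = ((s⁻¹ : ℝ) : ℂ) := by
        push_cast; field_simp
      simp only [hq, Complex.add_re, Complex.ofReal_re, Complex.re_ofReal_mul, Complex.sub_re,
        Complex.one_re] at h
      refine h.trans ?_
      rw [mul_assoc]
      gcongr
      have : s⁻¹ * s = 1 := inv_mul_cancel₀ hs0.ne'
      nlinarith [inv_pos.2 hs0, sq_nonneg (s - 1)]
    · rintro w ⟨-, hw⟩ rfl
      simp only [mem_ofPred_eq, norm_zero] at hw
      linarith
    · intro w hw
      have : w ≠ 0 := hw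
      exact DifferentiableAt.differentiableWithinAt (by fun_prop (disch := assumption))
    · intro w hw
      obtain ⟨hwB, hwK, hcase⟩ := hfr _ w hw hcl
        ((frontier_le_subset_eq continuous_const continuous_norm).trans fun w h => Eq.symm h)
      have hw0 : w ≠ 0 := by
        rintro rfl
        simp only [mem_ofPred_eq, norm_zero] at hwK
        linarith
      simp only [Complex.add_re, Complex.ofReal_re, Complex.re_ofReal_mul, Complex.sub_re,
        Complex.one_re]
      have hzi : c₁ / w = (w / c₁)⁻¹ := (inv_div w c₁).symm
      have hzle : 1 ≤ ‖w / c₁‖ := by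
        have : ‖c₁‖ * 1 ≤ ‖c₁‖ * ‖w / c₁‖ := by rw [← hscale]; simpa using hwK
        exact le_of_mul_le_mul_left this hn
      have hzre : (c₁ / w).re = (w / c₁).re / ‖w / c₁‖ ^ 2 := by
        rw [hzi, Complex.inv_re, Complex.sq_norm]
      rcases hcase with h | h
      · refine (hAB w hwB).trans ?_
        have hz := hone (w / c₁)
        have hz2 : ‖w / c₁‖ ≤ 2 := by
          have := norm_add_le (w / c₁ - 1) 1
          rw [sub_add_cancel, h, norm_one] at this
          linarith
        have h2 : 1 ≤ 8 / ρ ^ 2 * (1 - (c₁ / w).re) := by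
          rw [h] at hz
          have hr : 1 - (c₁ / w).re = (‖w / c₁‖ ^ 2 - 1 + ρ ^ 2) / 2 / ‖w / c₁‖ ^ 2 := by
            rw [hzre, hz]
            have : ‖w / c₁‖ ≠ 0 := by positivity
            field_simp
            ring
          rw [hr, div_mul_div_comm, le_div_iff₀ (by positivity)]
          have : ‖w / c₁‖ ^ 2 ≤ 4 := by nlinarith
          nlinarith [sq_nonneg ρ, mul_le_mul_of_nonneg_left this (sq_nonneg ρ)]
        nlinarith
      · refine (hA w hwB h).trans ?_
        have h2 : 0 ≤ 1 - (c₁ / w).re := by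
          have h3 := Complex.re_le_norm (c₁ / w)
          rw [norm_div, h, div_self hn.ne'] at h3
          linarith
        have : 0 ≤ B * (8 / ρ ^ 2) * (1 - (c₁ / w).re) := by positivity
        linarith
    · simp only [mem_ofPred_eq, norm_mul, Complex.norm_real, Real.norm_eq_abs, abs_of_pos hs0]
      nlinarith

end IsSubharmonicOn

/-! ### Toric rotations and restriction to coordinate lines. -/

variable {n : ℕ} {Ω : Set (Fin n → ℂ)} {u : (Fin n → ℂ) → ℝ}

/-- Uniform continuity of toric translations at the identity. -/
lemma IsToricallyUniformlyContinuousOn.exists_dist_lt (hT : IsToricallyUniformlyContinuousOn u Ω)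
    {ε : ℝ} (hε : 0 < ε) :
    ∃ δ > 0, ∀ ζ : Fin n → Circle, (∀ j, ‖(ζ j : ℂ) - 1‖ < δ) → ∀ z ∈ Ω,
      |u (toricAct ζ z) - u z| < ε := by
  obtain ⟨δ, hδ, h⟩ := Metric.equicontinuousAt_iff.1 (hT 1) ε hε
  refine ⟨δ, hδ, fun ζ hζ z hz => ?_⟩
  have h1 := h ζ ((dist_pi_lt_iff hδ).2 fun j => ?_) ⟨z, hz⟩
  · have h2 : toricAct (1 : Fin n → Circle) z = z := by ext j; simp [toricAct]
    simp only [h2] at h1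
    rwa [dist_comm, Real.dist_eq] at h1
  · change dist (ζ j : ℂ) ((1 : Circle) : ℂ) < δ
    simpa [dist_eq_norm] using hζ j

lemma toricAct_update_one (z : Fin n → ℂ) (j : Fin n) (ξ : Circle) :
    toricAct (Function.update 1 j ξ) z = Function.update z j (ξ * z j) := by
  ext i
  rcases eq_or_ne i j with rfl | h
  · simp [toricAct]
  · simp [toricAct, h]

/-- Changing the argument of one coordinate a little changes the function a little. -/
lemma abs_sub_update_lt {ε δ : ℝ} (hδ : 0 < δ)
    (h : ∀ ζ : Fin n → Circle, (∀ j, ‖(ζ j : ℂ) - 1‖ < δ) → ∀ z ∈ Ω, |u (toricAct ζ z) - u z| < ε)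
    {z : Fin n → ℂ} {j : Fin n} {a b : ℂ} (ha : a ≠ 0) (hab : ‖b‖ = ‖a‖)
    (hd : ‖b - a‖ < δ * ‖a‖) (hz : Function.update z j a ∈ Ω) :
    |u (Function.update z j b) - u (Function.update z j a)| < ε := by
  have ha' : 0 < ‖a‖ := norm_pos_iff.2 ha
  let ξ : Circle := ⟨b / a, by
    exact mem_sphere_zero_iff_norm.2 (by rw [norm_div, hab, div_self ha'.ne'])⟩
  have hξ : (ξ : ℂ) = b / a := rfl
  have h1 := h (Function.update 1 j ξ) (fun i => ?_) _ hz
  · rw [toricAct_update_one, Function.update_self, Function.update_idem, hξ,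
      div_mul_cancel₀ _ ha] at h1
    exact h1
  · rcases eq_or_ne i j with rfl | hij
    · rw [Function.update_self, hξ, div_sub_one ha, norm_div, div_lt_iff₀ ha']
      exact hd
    · simpa [hij] using hδ

lemma IsPlurisubharmonicOn.isSubharmonicOn_update
    (hu : IsPlurisubharmonicOn (fun z => (u z : EReal)) Ω) (p : Fin n → ℂ) (j : Fin n) :
    IsSubharmonicOn (fun w => (u (Function.update p j w) : EReal))
      {w | Function.update p j w ∈ Ω} := by
  have h := hu.isSubharmonicOn_line (Function.update p j 0) (Pi.single j 1)
  have he : ∀ w : ℂ, Function.update p j 0 + w • Pi.single j (1 : ℂ) = Function.update p j w := by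
    intro w
    ext i
    rcases eq_or_ne i j with rfl | hij
    · simp
    · simp [hij]
  simpa only [he] using h

lemma IsPlurisubharmonicOn.upperSemicontinuousOn_real
    (hu : IsPlurisubharmonicOn (fun z => (u z : EReal)) Ω) : UpperSemicontinuousOn u Ω :=
  fun x hx y hy => by
    simpa using hu.upperSemicontinuousOn x hx y (EReal.coe_lt_coe_iff.2 hy)

lemma IsPlurisubharmonicOn.exists_ball_lt (hΩ : IsOpen Ω)
    (hu : IsPlurisubharmonicOn (fun z => (u z : EReal)) Ω) {z₀ : Fin n → ℂ} (hz₀ : z₀ ∈ Ω)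
    {ε : ℝ} (hε : 0 < ε) : ∃ R > 0, ball z₀ R ⊆ Ω ∧ ∀ z ∈ ball z₀ R, u z < u z₀ + ε := by
  have h := hu.upperSemicontinuousOn_real z₀ hz₀ (u z₀ + ε) (by linarith)
  rw [hΩ.nhdsWithin_eq hz₀] at h
  obtain ⟨R, hR, hRs⟩ := Metric.mem_nhds_iff.1 (h.and (hΩ.mem_nhds hz₀))
  exact ⟨R, hR, fun z hz => (hRs hz).2, fun z hz => (hRs hz).1⟩

lemma update_mem_ball {z₀ p : Fin n → ℂ} {R : ℝ} (hp : p ∈ ball z₀ R) {j : Fin n} {a : ℂ}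
    (ha : ‖a - z₀ j‖ < R) : Function.update p j a ∈ ball z₀ R := by
  have hR : 0 < R := pos_of_mem_ball hp
  rw [mem_ball, dist_pi_lt_iff hR] at *
  intro i
  rcases eq_or_ne i j with rfl | hij
  · simpa [dist_eq_norm] using ha
  · simpa [hij] using hp i

/-! ### Lower estimates in the nonvanishing and in the vanishing coordinates. -/

/-- Lower estimate when one coordinate moves away from the coordinate hyperplane. -/
lemma exists_le_update_add (hΩ : IsOpen Ω)
    (hu : IsPlurisubharmonicOn (fun z => (u z : EReal)) Ω) (hbdd : BddBelow (u '' Ω))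
    (hT : IsToricallyUniformlyContinuousOn u Ω) {z₀ : Fin n → ℂ} (hz₀ : z₀ ∈ Ω) {j : Fin n}
    (hj : z₀ j ≠ 0) {ε : ℝ} (hε : 0 < ε) :
    ∃ r > 0, ∀ p ∈ ball z₀ r, ∀ a, ‖a - z₀ j‖ < r → u p ≤ u (Function.update p j a) + ε := by
  obtain ⟨R, hR, hRΩ, hM⟩ := hu.exists_ball_lt hΩ hz₀ one_pos
  obtain ⟨m, hm⟩ := hbdd
  replace hm : ∀ z ∈ Ω, m ≤ u z := fun z hz => hm (mem_image_of_mem u hz)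
  obtain ⟨δ, hδ, hδu⟩ := hT.exists_dist_lt (show 0 < ε / 3 by positivity)
  set d := ‖z₀ j‖ with hd
  have hd0 : 0 < d := norm_pos_iff.2 hj
  set B := u z₀ + 1 - m with hB
  have hB0 : 0 < B := by linarith [hm z₀ hz₀]
  -- `ρ < δ` puts the arc in the disc within reach of the toric estimate. `ρ` is fixed before `r`,
  -- so the barrier error tends to `0` with `r`.
  obtain ⟨ρ, hρ, hρ1, hρδ, hρR⟩ : ∃ ρ > 0, ρ ≤ 1 / 2 ∧ ρ < δ ∧ ρ * (2 * d) ≤ R / 2 := by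
    refine ⟨min (1 / 2) (min (δ / 2) (R / (4 * d))), by positivity, min_le_left _ _, ?_, ?_⟩
    · have := (min_le_right (1 / 2) (min (δ / 2) (R / (4 * d)))).trans (min_le_left _ _)
      linarith
    · have := (min_le_right (1 / 2) (min (δ / 2) (R / (4 * d)))).trans (min_le_right _ _)
      calc _ ≤ R / (4 * d) * (2 * d) := by gcongr
        _ = R / 2 := by field_simp; norm_num
  obtain ⟨r, hr, hrd, hrR, hrδ, hrρ, hrε⟩ : ∃ r > 0, r ≤ d / 2 ∧ r ≤ R / 6 ∧ 8 * r / d < δ ∧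
      4 * r / d ≤ ρ ∧ B * (8 / ρ ^ 2 * (4 * r / d)) ≤ ε / 3 := by
    have hcont : ∀ k : ℝ, Tendsto (fun r : ℝ => k * r / d) (𝓝[>] 0) (𝓝 0) := fun k => by
      have : Tendsto (fun r : ℝ => k * r / d) (𝓝 0) (𝓝 (k * 0 / d)) :=
        ((continuous_const.mul continuous_id).div_const d).tendsto 0
      rw [mul_zero, zero_div] at this
      exact this.mono_left nhdsWithin_le_nhds
    have h5 : Tendsto (fun r : ℝ => B * (8 / ρ ^ 2 * (4 * r / d))) (𝓝[>] 0) (𝓝 0) := by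
      simpa using ((hcont 4).const_mul (8 / ρ ^ 2)).const_mul B
    have hid : Tendsto (fun r : ℝ => r) (𝓝[>] 0) (𝓝 0) :=
      tendsto_id.mono_left nhdsWithin_le_nhds
    obtain ⟨r, h⟩ := ((eventually_mem_nhdsWithin (a := (0 : ℝ)) (s := Ioi 0)).and
      ((hid.eventually_le_const (show 0 < d / 2 by positivity)).and
      ((hid.eventually_le_const (show 0 < R / 6 by positivity)).and
      (((hcont 8).eventually_lt_const hδ).and (((hcont 4).eventually_le_const hρ).and
      (h5.eventually_le_const (show 0 < ε / 3 by positivity))))))).exists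
    exact ⟨r, h⟩
  refine ⟨r, hr, fun p hp a ha => ?_⟩
  have hpR : p ∈ ball z₀ R := ball_subset_ball (by linarith) hp
  have hpj : ‖p j - z₀ j‖ < r := by
    rw [← dist_eq_norm]; exact (dist_le_pi_dist p z₀ j).trans_lt hp
  have hap : ‖a - p j‖ < 2 * r := by
    have := norm_sub_le (a - z₀ j) (p j - z₀ j)
    rw [sub_sub_sub_cancel_right] at this
    linarith
  have hnorm : ∀ w : ℂ, ‖w - z₀ j‖ < r → d / 2 < ‖w‖ ∧ ‖w‖ < 2 * d := fun w hw => by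
    have h1 := norm_sub_norm_le (z₀ j) w
    have h2 := norm_sub_norm_le w (z₀ j)
    rw [norm_sub_rev] at h1
    constructor <;> linarith
  obtain ⟨ha1, ha2⟩ := hnorm a ha
  obtain ⟨hp1, hp2⟩ := hnorm _ hpj
  have ha0 : a ≠ 0 := norm_pos_iff.1 (by linarith)
  have hp0 : p j ≠ 0 := norm_pos_iff.1 (by linarith)
  set t := ‖a‖ / ‖p j‖ with ht
  have ht0 : 0 < t := by rw [ht]; apply div_pos <;> linarith
  -- `c₁` has the argument of `p j` and the modulus of `a`: passing from `a` to `c₁` is a rotation,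
  -- from `c₁` to `p j` a radial move. The rotation, the oscillation on the arc and the barrier each
  -- cost `ε / 3`.
  set c₁ : ℂ := t * p j with hc₁
  have hc₁n : ‖c₁‖ = ‖a‖ := by
    rw [hc₁, norm_mul, Complex.norm_real, Real.norm_eq_abs, abs_of_pos ht0, ht]
    field_simp
  have hc₁p : ‖c₁ - p j‖ < 2 * r := by
    have : c₁ - p j = ((t - 1 : ℝ) : ℂ) * p j := by rw [hc₁]; push_cast; ring
    rw [this, norm_mul, Complex.norm_real, Real.norm_eq_abs]
    have : |t - 1| * ‖p j‖ = |‖a‖ - ‖p j‖| := by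
      rw [← abs_of_pos (show 0 < ‖p j‖ by linarith), ← abs_mul,
        abs_of_pos (show 0 < ‖p j‖ by linarith), ht]
      congr 1
      field_simp
    rw [this]
    exact (abs_norm_sub_norm_le _ _).trans_lt hap
  have hc₁0 : c₁ ≠ 0 := norm_pos_iff.1 (by linarith)
  have hc₁z : ‖c₁ - z₀ j‖ < 3 * r := by
    have := norm_add_le (c₁ - p j) (p j - z₀ j)
    rw [sub_add_sub_cancel] at this
    linarith
  have hmemR : ∀ w : ℂ, ‖w - z₀ j‖ < R → Function.update p j w ∈ ball z₀ R := fun w hw =>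
    update_mem_ball hpR hw
  have hdisc : ∀ w ∈ closedBall c₁ (ρ * ‖c₁‖), Function.update p j w ∈ ball z₀ R := by
    intro w hw
    apply hmemR
    have h1 := norm_add_le (w - c₁) (c₁ - z₀ j)
    rw [sub_add_sub_cancel] at h1
    rw [mem_closedBall, dist_eq_norm, hc₁n] at hw
    have : ρ * ‖a‖ < ρ * (2 * d) := by gcongr
    linarith
  have hts : |1 - t⁻¹| ≤ 4 * r / d := by
    have h1 : 1 - t⁻¹ = (‖a‖ - ‖p j‖) / ‖a‖ := by
      rw [ht, inv_div, sub_div, div_self (norm_ne_zero_iff.2 ha0)]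
    rw [h1, abs_div, abs_norm, div_le_div_iff₀ (by linarith) hd0]
    have := (abs_norm_sub_norm_le a (p j)).trans_lt hap
    nlinarith
  have hq := abs_sub_update_lt hδ hδu (z := p) (j := j) (a := a) (b := c₁) ha0 hc₁n (by
    have h1 := norm_sub_le (c₁ - p j) (a - p j)
    rw [sub_sub_sub_cancel_right] at h1
    rw [div_lt_iff₀ hd0] at hrδ
    nlinarith) (hRΩ (hmemR a (by linarith)))
  have hc₁Ω : Function.update p j c₁ ∈ Ω := hRΩ (hmemR c₁ (by linarith))
  have key := (hu.isSubharmonicOn_update p j).le_of_le_on_arc (f := fun w => u (Function.update p j w))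
    hc₁0 hρ hρ1 (fun w hw => hRΩ (hdisc w hw)) (A := u (Function.update p j c₁) + ε / 3) hB0.le
    (fun w hw => by
      have h1 := hM _ (hdisc w hw)
      have h2 := hm _ hc₁Ω
      simp only [hB]
      linarith)
    (fun w hw hwn => by
      have h1 := abs_sub_update_lt hδ hδu (z := p) (j := j) (a := c₁) (b := w) hc₁0 hwn (by
        rw [mem_closedBall, dist_eq_norm] at hw
        refine hw.trans_lt ?_
        gcongr) hc₁Ω
      linarith [(abs_lt.1 h1).2])
    (s := t⁻¹) ?_
  · have h1 : ((t⁻¹ : ℝ) : ℂ) * c₁ = p j := by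
      rw [hc₁, ← mul_assoc, ← Complex.ofReal_mul, inv_mul_cancel₀ ht0.ne']; simp
    simp only [h1, Function.update_eq_self] at key
    have h2 : B * (8 / ρ ^ 2 * |1 - t⁻¹|) ≤ B * (8 / ρ ^ 2 * (4 * r / d)) := by
      gcongr
    linarith [(abs_lt.1 hq).2]
  · exact hts.trans hrρ

/-- Lower estimate when several coordinates move away from the coordinate hyperplanes. -/
lemma exists_le_add_of_eqOn_compl (hΩ : IsOpen Ω)
    (hu : IsPlurisubharmonicOn (fun z => (u z : EReal)) Ω) (hbdd : BddBelow (u '' Ω))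
    (hT : IsToricallyUniformlyContinuousOn u Ω) {z₀ : Fin n → ℂ} (hz₀ : z₀ ∈ Ω)
    (S : Finset (Fin n)) (hS : ∀ j ∈ S, z₀ j ≠ 0) {ε : ℝ} (hε : 0 < ε) :
    ∃ r > 0, ∀ p ∈ ball z₀ r, ∀ q ∈ ball z₀ r, (∀ i ∉ S, p i = q i) → u p ≤ u q + ε := by
  induction S using Finset.induction_on generalizing ε with
  | empty =>
    refine ⟨1, one_pos, fun p _ q _ h => ?_⟩
    rw [funext fun i => h i (Finset.notMem_empty i)]
    linarith
  | insert j S hjS ih =>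
    obtain ⟨r₁, hr₁, h₁⟩ := ih (fun i hi => hS i (Finset.mem_insert_of_mem hi)) (half_pos hε)
    obtain ⟨r₂, hr₂, h₂⟩ := exists_le_update_add hΩ hu hbdd hT hz₀
      (hS j (Finset.mem_insert_self j S)) (half_pos hε)
    refine ⟨min r₁ r₂, lt_min hr₁ hr₂, fun p hp q hq h => ?_⟩
    have hqj : ‖q j - z₀ j‖ < min r₁ r₂ := by
      rw [← dist_eq_norm]; exact (dist_le_pi_dist q z₀ j).trans_lt hq
    have e₂ := h₂ p (ball_subset_ball (min_le_right _ _) hp) (q j)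
      (hqj.trans_le (min_le_right _ _))
    have e₁ := h₁ (Function.update p j (q j))
      (ball_subset_ball (min_le_left _ _) (update_mem_ball hp hqj)) q
      (ball_subset_ball (min_le_left _ _) hq) fun i hi => by
        rcases eq_or_ne i j with rfl | hij
        · simp
        · simpa [hij] using h i (by simp [hij, hi])
    linarith

/-- Lower estimate when the vanishing coordinates move. -/
lemma exists_le_add_of_eq_of_ne_zero (hΩ : IsOpen Ω)
    (hu : IsPlurisubharmonicOn (fun z => (u z : EReal)) Ω)
    (hT : IsToricallyUniformlyContinuousOn u Ω) {z₀ : Fin n → ℂ} (hz₀ : z₀ ∈ Ω)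
    {ε : ℝ} (hε : 0 < ε) :
    ∃ r > 0, ∀ z ∈ ball z₀ r, (∀ j, z₀ j ≠ 0 → z j = z₀ j) → u z₀ ≤ u z + ε := by
  obtain ⟨δ, hδ, hδu⟩ := hT.exists_dist_lt (half_pos hε)
  obtain ⟨φ, hφ, hφ1, hφδ⟩ : ∃ φ > (0 : ℝ), φ ≤ 1 ∧ ∀ θ ∈ Ioc 0 φ,
      ‖Complex.exp (θ * Complex.I) - 1‖ < δ := by
    have hc : ContinuousAt (fun θ : ℝ => ‖Complex.exp (θ * Complex.I) - 1‖) 0 := by fun_prop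
    have h0 := hc.eventually_lt_const (u := δ) (by simpa using hδ)
    obtain ⟨φ, hφ, h⟩ := Metric.eventually_nhds_iff.1 h0
    refine ⟨min 1 (φ / 2), by positivity, min_le_left _ _, fun θ hθ => h ?_⟩
    have := hθ.2.trans (min_le_right _ _)
    rw [Real.dist_eq, sub_zero, abs_of_pos hθ.1]
    linarith
  -- A deficit of `ε / 2` on an arc of length `φ` lowers the mean by `ε * φ / (4π) = 2 * η`, twice
  -- the excess `η` allowed on the circle.
  set η := ε * φ / (8 * Real.pi) with hη
  have hη0 : 0 < η := by have := Real.pi_pos; positivity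
  obtain ⟨r, hr, hrΩ, hru⟩ := hu.exists_ball_lt hΩ hz₀ hη0
  refine ⟨r, hr, fun z hz hzj => ?_⟩
  by_contra! hlt
  have hline : ∀ c : ℂ, ‖c‖ ≤ 1 → z₀ + c • (z - z₀) ∈ ball z₀ r := fun c hc => by
    rw [mem_ball, dist_eq_norm, add_sub_cancel_left, norm_smul]
    rw [mem_ball, dist_eq_norm] at hz
    exact (mul_le_of_le_one_left (norm_nonneg _) hc).trans_lt hz
  have hsub := hu.isSubharmonicOn_line z₀ (z - z₀)
  have hexp : ∀ θ : ℝ, circleMap 0 1 θ = Complex.exp (θ * Complex.I) := fun θ => by simp [circleMap]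
  have hpi : φ ≤ 2 * Real.pi := by linarith [Real.pi_gt_three]
  have hsubset : Ioc 0 φ ⊆ Ioc 0 (2 * Real.pi) := Ioc_subset_Ioc_right hpi
  have hI : IntegrableOn (fun θ => u z₀ + η - (Ioc 0 φ).indicator (fun _ => ε / 2) θ)
      (Ioc 0 (2 * Real.pi)) :=
    Integrable.sub (integrable_const _) ((integrable_const _).indicator measurableSet_Ioc)
  have h := hsub.le_setAverage (f := fun c : ℂ => u (z₀ + c • (z - z₀))) (c := 0) one_pos
    (fun c hc => hrΩ (hline c (by simpa using hc))) hI ?_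
  · rw [setAverage_eq, integral_sub (integrable_const _)
      ((integrable_const _).indicator measurableSet_Ioc),
      setIntegral_indicator measurableSet_Ioc, inter_eq_right.2 hsubset] at h
    simp only [setIntegral_const, Real.volume_real_Ioc, sub_zero, smul_eq_mul, zero_smul,
      add_zero, max_eq_left hφ.le, max_eq_left (show 0 ≤ 2 * Real.pi by positivity)] at h
    have h2 : (2 * Real.pi)⁻¹ * (2 * Real.pi * (u z₀ + η) - φ * (ε / 2)) = u z₀ + η - 2 * η := by
      rw [hη]; field_simp; ring
    linarith
  · intro θ
    have hmem := hline (circleMap 0 1 θ) (by simp)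
    by_cases hθ : θ ∈ Ioc 0 φ
    · rw [indicator_of_mem hθ]
      have h1 := hδu (fun j => if z₀ j = 0 then Circle.exp θ else 1) (fun j => by
        split_ifs
        · simpa using hφδ θ hθ
        · simpa using hδ) z (hrΩ hz)
      -- Since `z - z₀` is supported on the vanishing coordinates, turning around this complex line
      -- is a toric rotation.
      have h2 : toricAct (fun j => if z₀ j = 0 then Circle.exp θ else 1) z =
          z₀ + circleMap 0 1 θ • (z - z₀) := by
        ext j
        by_cases hj : z₀ j = 0
        · simp [toricAct, hj, hexp]
        · simp [toricAct, hj, hzj j hj]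
      rw [h2] at h1
      linarith [(abs_lt.1 h1).2]
    · rw [indicator_of_notMem hθ, sub_zero]
      exact (hru _ hmem).le

end

open Set Filter Topology Metric

theorem corollary3p2 (n : ℕ) (Ω : Set (Fin n → ℂ)) (hΩ : IsReinhardtDomain Ω)
    (u : (Fin n → ℂ) → ℝ)
    (hpsh : IsPlurisubharmonicOn (fun z => (u z : EReal)) Ω)
    (hbdd : BddBelow (u '' Ω))
    (hT : IsToricallyUniformlyContinuousOn u Ω) :
    ContinuousOn u Ω := by
  refine continuousOn_iff_lower_upperSemicontinuousOn.2
    ⟨fun z₀ hz₀ y hy => ?_, hpsh.upperSemicontinuousOn_real⟩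
  set ε := (u z₀ - y) / 3 with hε
  have hε0 : 0 < ε := by
    have : 0 < u z₀ - y := sub_pos.2 hy
    positivity
  obtain ⟨r₁, hr₁, h₁⟩ := exists_le_add_of_eq_of_ne_zero hΩ.isOpen hpsh hT hz₀ hε0
  obtain ⟨r₂, hr₂, h₂⟩ := exists_le_add_of_eqOn_compl hΩ.isOpen hpsh hbdd hT hz₀
    {j | z₀ j ≠ 0} (by simp) hε0
  refine mem_nhdsWithin_of_mem_nhds (mem_of_superset (ball_mem_nhds z₀ (lt_min hr₁ hr₂)) ?_)
  intro z hz
  -- The path goes from `z₀` to `p` in the vanishing coordinates, then to `z` in the others; each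
  -- leg costs `ε`, a third of `u z₀ - y`.
  let p : Fin n → ℂ := fun j => if z₀ j = 0 then z j else z₀ j
  have hp : p ∈ ball z₀ (min r₁ r₂) := by
    rw [mem_ball, dist_pi_lt_iff (lt_min hr₁ hr₂)] at *
    intro j
    by_cases hj : z₀ j = 0
    · simpa [p, hj] using hz j
    · simp [p, hj, hr₁, hr₂]
  have e₁ := h₁ p (ball_subset_ball (min_le_left _ _) hp) fun j hj => by simp [p, hj]
  have e₂ := h₂ p (ball_subset_ball (min_le_right _ _) hp) z
    (ball_subset_ball (min_le_right _ _) hz) fun j hj => by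
      have : z₀ j = 0 := by simpa using hj
      simp [p, this]
  change y < u z
  linarith
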